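/- Let $\ell\ge 2$ and $n=2^\ell$, and consider a knockout tournament with players $[n]=\{1,\dots,n\}$ of equal strength: for $i\ne j$, player $i$ defeats player $j$ with probability $1/2$, and the duels of different pairs of players are independent. The schedule is deterministic: it is a bracket fixed in advance, that is, a complete binary tree of depth $\ell$ whose $2^\ell$ leaves are labelled bijectively by the players; at every inner node the winners of its two subtrees play each other, the winner moves on and the loser is eliminated. Let $S_i$ be the number of games won by player $i$, and let $\boldsymbol S=(S_1,\dots,S_n)$. Then: (a) $\boldsymbol S$ is negatively associated (NA): for all disjoint $A_1,A_2\subset[n]$ and all coordinatewise (weakly) increasing functions $\psi_1:\mathbb R^{A_1}\to\mathbb R$, $\psi_2:\mathbb R^{A_2}\to\mathbb R$ for which the covariance exists, $$\operatorname{Cov}\big(\psi_1(S_i,\,i\in A_1),\ \psi_2(S_i,\,i\in A_2)\big)\le 0 .$$ (b) Hence $\boldsymbol S$ is negatively supermodular dependent (NSMD): for every $\psi:\mathbb R^n\to\mathbb R$ with $\psi(\boldsymbol x\vee\boldsymbol y)+\psi(\boldsymbol x\wedge\boldsymbol y)\ge\psi(\boldsymbol x)+\psi(\boldsymbol y)$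 for all $\boldsymbol x,\boldsymbol y\in\mathbb R^n$ ($\vee$, $\wedge$ the componentwise maximum and minimum) for which the expectations exist, $$\mathbb E[\psi(\boldsymbol S)]\le \mathbb E[\psi(\boldsymbol S^\perp)],$$ where $\boldsymbol S^\perp=(S_1^\perp,\dots,S_n^\perp)$ has independent components and $S_i^\perp$ has the same distribution as $S_i$ for each $i$. -/

import Mathlib

open MeasureTheory ProbabilityTheory

/-- A random vector `X = (X i)` is negatively associated: for disjoint index sets `A₁`, `A₂` and
coordinatewise increasing `ψ₁`, `ψ₂`, `Cov (ψ₁ (X_{A₁}), ψ₂ (X_{A₂})) ≤ 0` whenever this covariance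
exists, that is, whenever the two factors and their product are integrable. -/
def IsNegAssoc {Ω ι : Type*} [MeasurableSpace Ω] (μ : Measure Ω) (X : ι → Ω → ℝ) : Prop :=
  (∀ i, AEMeasurable (X i) μ) ∧
  ∀ A₁ A₂ : Set ι, Disjoint A₁ A₂ →
    ∀ (ψ₁ : (A₁ → ℝ) → ℝ) (ψ₂ : (A₂ → ℝ) → ℝ), Monotone ψ₁ → Monotone ψ₂ →
      Integrable (fun ω => ψ₁ (fun i => X i ω)) μ →
      Integrable (fun ω => ψ₂ (fun i => X i ω)) μ →
      Integrable (fun ω => ψ₁ (fun i => X i ω) * ψ₂ (fun i => X i ω)) μ →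
      covariance (fun ω => ψ₁ (fun i => X i ω)) (fun ω => ψ₂ (fun i => X i ω)) μ ≤ 0

/-- `ψ (x ∨ y) + ψ (x ∧ y) ≥ ψ x + ψ y`, with componentwise maximum and minimum. -/
def IsSupermodular {ι : Type*} (ψ : (ι → ℝ) → ℝ) : Prop :=
  ∀ x y : ι → ℝ, ψ x + ψ y ≤ ψ (x ⊔ y) + ψ (x ⊓ y)

/-- A random vector `X` is negatively supermodular dependent: `E ψ(X) ≤ E ψ(X^⊥)` for every
supermodular `ψ` for which both expectations exist, where `X^⊥` has independent components with the
same marginals as `X`, so that its law is the product of the marginal laws of `X`. -/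
def IsNSMD {Ω ι : Type*} [MeasurableSpace Ω] [Fintype ι] (μ : Measure Ω) (X : ι → Ω → ℝ) : Prop :=
  (∀ i, AEMeasurable (X i) μ) ∧
  ∀ ψ : (ι → ℝ) → ℝ, IsSupermodular ψ →
    Integrable (fun ω => ψ (fun i => X i ω)) μ →
    Integrable ψ (Measure.pi fun i => μ.map (X i)) →
    ∫ ω, ψ (fun i => X i ω) ∂μ ≤ ∫ x, ψ x ∂(Measure.pi fun i => μ.map (X i))

/-- A bracket with `ℓ` rounds on a set `P` of players: a player alone (no round), or two brackets
with `ℓ` rounds each, whose winners meet in round `ℓ + 1`. -/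
inductive KnockoutBracket (P : Type*) : ℕ → Type _
  | player (i : P) : KnockoutBracket P 0
  | duel {ℓ : ℕ} (A B : KnockoutBracket P ℓ) : KnockoutBracket P (ℓ + 1)

namespace KnockoutBracket

variable {P Ω : Type*}

/-- The players entered in the bracket, in order of position. -/
def entrants : {ℓ : ℕ} → KnockoutBracket P ℓ → List P
  | _, player i => [i]
  | _, duel A B => A.entrants ++ B.entrants

/-- The bracket is a draw of all players: each player occupies exactly one position. -/
def IsDraw [DecidableEq P] {ℓ : ℕ} (B : KnockoutBracket P ℓ) : Prop :=
  ∀ i : P, B.entrants.count i = 1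

open Classical in
/-- The winner of the bracket when `D i j` is the event that `i` defeats `j`. -/
noncomputable def winner (D : P → P → Set Ω) : {ℓ : ℕ} → KnockoutBracket P ℓ → Ω → P
  | _, player i, _ => i
  | _, duel A B, ω =>
      if ω ∈ D (A.winner D ω) (B.winner D ω) then A.winner D ω else B.winner D ω

open Classical in
/-- The number of games won by player `i` in the bracket. -/
noncomputable def gamesWon (D : P → P → Set Ω) (i : P) :
    {ℓ : ℕ} → KnockoutBracket P ℓ → Ω → ℕ
  | _, player _, _ => 0
  | _, duel A B, ω =>
      A.gamesWon D i ω + B.gamesWon D i ω + if (duel A B).winner D ω = i then 1 else 0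

end KnockoutBracket

/-- Outcomes of the duels between `n` players: `D i j` is the event that player `i` defeats player
`j`, it has probability `p i j`, exactly one of `i`, `j` wins their duel, and the duels of
different pairs are independent. (The diagonal `D i i` plays no role.) -/
structure IsDuelModel {Ω : Type*} [MeasurableSpace Ω] (μ : Measure Ω) {n : ℕ}
    (p : Fin n → Fin n → ℝ) (D : Fin n → Fin n → Set Ω) : Prop where
  measurableSet : ∀ i j, i ≠ j → MeasurableSet (D i j)
  compl : ∀ i j, i ≠ j → D j i = (D i j)ᶜ
  prob : ∀ i j, i ≠ j → μ.real (D i j) = p i j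
  indep : iIndepSet (fun e : {e : Fin n × Fin n // e.1 < e.2} => D e.1.1 e.1.2) μ

/-- The players are of equal strength: each wins each duel with probability `1 / 2`. -/
def EqualStrength {n : ℕ} (p : Fin n → Fin n → ℝ) : Prop :=
  ∀ i j, i ≠ j → p i j = 1 / 2

open Finset
open scoped BigOperators

/-- Negative association of a vector `X` on a finite set with the uniform distribution. -/
def IsUniformNegAssoc {α ι : Type*} [Fintype α] (X : α → ι → ℝ) : Prop :=
  ∀ (A : Set ι) (f g : (ι → ℝ) → ℝ), Monotone f → Monotone g → DependsOn f A → DependsOn g Aᶜ →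
    𝔼 a, f (X a) * g (X a) ≤ (𝔼 a, f (X a)) * 𝔼 a, g (X a)

/-- Outcomes of fair coins, one for each inner node of a complete binary tree of given depth. -/
def CoinTree : ℕ → Type
  | 0 => Unit
  | ℓ + 1 => CoinTree ℓ × CoinTree ℓ × Bool

namespace CoinTree

instance instFintype : (ℓ : ℕ) → Fintype (CoinTree ℓ)
  | 0 => inferInstanceAs (Fintype Unit)
  | ℓ + 1 =>
    letI := instFintype ℓ
    inferInstanceAs (Fintype (CoinTree ℓ × CoinTree ℓ × Bool))

instance instNonempty : (ℓ : ℕ) → Nonempty (CoinTree ℓ)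
  | 0 => inferInstanceAs (Nonempty Unit)
  | ℓ + 1 =>
    letI := instNonempty ℓ
    inferInstanceAs (Nonempty (CoinTree ℓ × CoinTree ℓ × Bool))

theorem expect_zero (f : CoinTree 0 → ℝ) : 𝔼 c, f c = f () :=
  Fintype.expect_equiv (Equiv.refl Unit) f (fun _ => f ()) (fun _ => rfl) |>.trans (by simp)

theorem expect_succ {ℓ : ℕ} (f : CoinTree (ℓ + 1) → ℝ) :
    𝔼 c, f c = 𝔼 a, 𝔼 b, (f (a, b, true) + f (a, b, false)) / 2 := by
  let F (c : CoinTree ℓ × CoinTree ℓ × Bool) : ℝ := f c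
  change 𝔼 c, F c = 𝔼 a, 𝔼 b, (F (a, b, true) + F (a, b, false)) / 2
  rw [← univ_product_univ, expect_product]
  refine expect_congr rfl fun a _ => ?_
  rw [← univ_product_univ, expect_product]
  refine expect_congr rfl fun b _ => ?_
  rw [Fintype.expect_eq_sum_div_card, Fintype.sum_bool, Fintype.card_bool, Nat.cast_ofNat]

end CoinTree

namespace KnockoutBracket

variable {P Ω : Type*}

open Classical in
/-- The numbers of games won and the winner, when coins decide the games of the bracket. -/
noncomputable def outcome : {ℓ : ℕ} → KnockoutBracket P ℓ → CoinTree ℓ → (P → ℕ) × P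
  | _, player i, _ => (0, i)
  | _, duel A B, (a, b, c) =>
      let w := bif c then (A.outcome a).2 else (B.outcome b).2
      (fun i => (A.outcome a).1 i + (B.outcome b).1 i + if w = i then 1 else 0, w)

theorem outcome_spec {ℓ : ℕ} (B : KnockoutBracket P ℓ) (hB : B.entrants.Nodup) (c : CoinTree ℓ) :
    (B.outcome c).2 ∈ B.entrants ∧ (∀ i, (B.outcome c).1 i ≤ ℓ) ∧
      (∀ i ∈ B.entrants, ℓ ≤ (B.outcome c).1 i ↔ (B.outcome c).2 = i) ∧
      ∀ i ∉ B.entrants, (B.outcome c).1 i = 0 := by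
  induction B with
  | player i => simp [outcome, entrants, eq_comm]
  | duel A B ihA ihB =>
    obtain ⟨a, b, c⟩ := c
    simp only [entrants, List.nodup_append'] at hB
    obtain ⟨hA, hB, hAB⟩ := hB
    obtain ⟨a1, a2, a3, a4⟩ := ihA hA a
    obtain ⟨b1, b2, b3, b4⟩ := ihB hB b
    have hd : ∀ i, i ∈ A.entrants → i ∈ B.entrants → False := fun i h h' => hAB h h'
    simp only [outcome, entrants, List.mem_append]
    generalize A.outcome a = x at *
    generalize B.outcome b = y at *
    have key : ∀ i, (i ∈ A.entrants ∧ i ∉ B.entrants) ∨ (i ∉ A.entrants ∧ i ∈ B.entrants) ∨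
        (i ∉ A.entrants ∧ i ∉ B.entrants) := fun i => by
      have := hd i
      tauto
    have hxA : x.2 ∉ B.entrants := fun h => hd _ a1 h
    have hyB : y.2 ∉ A.entrants := fun h => hd _ h b1
    refine ⟨by cases c <;> simp [a1, b1], fun i => ?_, fun i hi => ?_, fun i hi => ?_⟩
    all_goals
      have h1 := a2 i
      have h2 := b2 i
      have h3 := a3 i
      have h4 := a4 i
      have h5 := b3 i
      have h6 := b4 i
      have h7 := key i
      cases c <;> simp only [cond_true, cond_false] <;> split_ifs with h <;> grind

/-- The numbers of games won, as reals. -/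
noncomputable def score {ℓ : ℕ} (B : KnockoutBracket P ℓ) (c : CoinTree ℓ) (i : P) : ℝ :=
  (B.outcome c).1 i

end KnockoutBracket

open Classical in
/-- The increasing map which adds `c` to the coordinates in `E` that are at least `r`. -/
noncomputable def raise {P : Type*} (E : Set P) (r c : ℝ) (x : P → ℝ) (i : P) : ℝ :=
  if i ∈ E ∧ r ≤ x i then x i + c else x i

theorem raise_mono {P : Type*} (E : Set P) (r : ℝ) {c : ℝ} (hc : 0 ≤ c) :
    Monotone (raise E r c) := by
  intro x y hxy i
  have := hxy i
  simp only [raise]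
  split_ifs with h1 h2 h2
  · linarith
  · exact absurd ⟨h1.1, h1.2.trans this⟩ h2
  · linarith
  · exact this

theorem raise_congr {P : Type*} (E : Set P) (r c : ℝ) {x y : P → ℝ} {i : P} (h : x i = y i) :
    raise E r c x i = raise E r c y i := by
  unfold raise
  rw [h]

namespace KnockoutBracket

variable {P : Type*}

open Classical in
theorem raise_score {ℓ : ℕ} (B : KnockoutBracket P ℓ) (hB : B.entrants.Nodup) (c : CoinTree ℓ)
    (r : ℝ) : raise {i | i ∈ B.entrants} ℓ r (B.score c) =
      B.score c + Pi.single (B.outcome c).2 r := by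
  obtain ⟨h1, -, h3, -⟩ := B.outcome_spec hB c
  ext i
  simp only [raise, score, Set.mem_ofPred_eq, Nat.cast_le, Pi.add_apply, Pi.single_apply]
  by_cases hi : i ∈ B.entrants
  · simp only [hi, true_and, h3 i hi, eq_comm (a := i)]
    split_ifs <;> simp
  · have : i ≠ (B.outcome c).2 := fun h => hi (h ▸ h1)
    simp [hi, this]

open Classical in
theorem score_duel {ℓ : ℕ} (A B : KnockoutBracket P ℓ) (a b : CoinTree ℓ) (c : Bool) :
    (A.duel B).score (a, b, c) = A.score a + B.score b +
      Pi.single (bif c then (A.outcome a).2 else (B.outcome b).2) 1 := by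
  ext i
  simp [score, outcome, Pi.single_apply, eq_comm]

end KnockoutBracket

/-- Two increasing functions of disjoint sets of coordinates are negatively correlated when a fair
coin decides which of two coordinates is increased. -/
theorem expect_mul_le_of_single {P : Type*} [DecidableEq P] {A : Set P} {f g : (P → ℝ) → ℝ}
    (hf : Monotone f) (hg : Monotone g) (hfA : DependsOn f A) (hgA : DependsOn g Aᶜ)
    (z : P → ℝ) (v w : P) :
    (f (z + Pi.single v 1) * g (z + Pi.single v 1) +
      f (z + Pi.single w 1) * g (z + Pi.single w 1)) / 2 ≤
    (f (z + Pi.single v 1) + f (z + Pi.single w 1)) / 2 *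
      ((g (z + Pi.single v 1) + g (z + Pi.single w 1)) / 2) := by
  have hle : ∀ u : P, z ≤ z + Pi.single u 1 := fun u =>
    le_add_of_nonneg_right (Pi.single_nonneg.2 zero_le_one)
  have hf0 : ∀ u ∉ A, f (z + Pi.single u 1) = f z := fun u hu => hfA fun i hi => by
    have : i ≠ u := fun h => hu (h ▸ hi)
    simp [this]
  have hg0 : ∀ u ∈ A, g (z + Pi.single u 1) = g z := fun u hu => hgA fun i hi => by
    have : i ≠ u := fun h => hi (h ▸ hu)
    simp [this]
  have key : (f (z + Pi.single v 1) - f (z + Pi.single w 1)) *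
      (g (z + Pi.single v 1) - g (z + Pi.single w 1)) ≤ 0 := by
    by_cases hv : v ∈ A <;> by_cases hw : w ∈ A
    · simp [hg0 v hv, hg0 w hw]
    · rw [hg0 v hv, hf0 w hw]
      exact mul_nonpos_of_nonneg_of_nonpos (sub_nonneg.2 (hf (hle v))) (sub_nonpos.2 (hg (hle w)))
    · rw [hf0 v hv, hg0 w hw]
      exact mul_nonpos_of_nonpos_of_nonneg (sub_nonpos.2 (hf (hle w))) (sub_nonneg.2 (hg (hle v)))
    · simp [hf0 v hv, hf0 w hw]
  linarith

theorem Monotone.expect {α β : Type*} [Fintype α] [Preorder β] {F : α → β → ℝ}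
    (h : ∀ a, Monotone (F a)) : Monotone fun x => 𝔼 a, F a x :=
  fun _ _ hxy => expect_le_expect fun a _ => h a hxy

theorem DependsOn.expect {α ι : Type*} [Fintype α] {A : Set ι} {F : α → (ι → ℝ) → ℝ}
    (h : ∀ a, DependsOn (F a) A) : DependsOn (fun x => 𝔼 a, F a x) A :=
  fun _ _ hxy => expect_congr rfl fun a _ => h a hxy

namespace KnockoutBracket

variable {P : Type*}

theorem isUniformNegAssoc_score {ℓ : ℕ} (B : KnockoutBracket P ℓ) (hB : B.entrants.Nodup) :
    IsUniformNegAssoc B.score := by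
  classical
  induction B with
  | player i =>
    intro A f g _ _ _ _
    simp only [CoinTree.expect_zero, le_refl]
  | @duel ℓ A B ihA ihB =>
    simp only [entrants, List.nodup_append'] at hB
    obtain ⟨hA, hB, -⟩ := hB
    intro T f g hf hg hfT hgT
    let U : Set P := {i | i ∈ A.entrants}
    let V : Set P := {i | i ∈ B.entrants}
    let avg (h : (P → ℝ) → ℝ) (x y : P → ℝ) : ℝ :=
      (h (raise U ℓ 1 x + raise V ℓ 0 y) + h (raise U ℓ 0 x + raise V ℓ 1 y)) / 2
    have havg : ∀ h : (P → ℝ) → ℝ, ∀ a b,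
        (h ((A.duel B).score (a, b, true)) + h ((A.duel B).score (a, b, false))) / 2 =
          avg h (A.score a) (B.score b) := by
      intro h a b
      simp only [avg, U, V, raise_score A hA, raise_score B hB, score_duel, cond_true, cond_false,
        Pi.single_zero, add_zero]
      rw [add_right_comm, ← add_assoc]
    have monoL : ∀ h, Monotone h → ∀ y, Monotone fun x => avg h x y := by
      intro h hh y x x' hx
      have h1 := hh (add_le_add_left (raise_mono U ℓ zero_le_one hx) (raise V ℓ 0 y))
      have h0 := hh (add_le_add_left (raise_mono U ℓ le_rfl hx) (raise V ℓ 1 y))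
      simp only [avg]
      linarith
    have monoR : ∀ h, Monotone h → ∀ x, Monotone fun y => avg h x y := by
      intro h hh x y y' hy
      have h1 := hh (add_le_add_right (raise_mono V ℓ le_rfl hy) (raise U ℓ 1 x))
      have h0 := hh (add_le_add_right (raise_mono V ℓ zero_le_one hy) (raise U ℓ 0 x))
      simp only [avg]
      linarith
    have depL : ∀ (h) (T : Set P), DependsOn h T → ∀ y, DependsOn (fun x => avg h x y) T := by
      intro h T hh y x x' hx
      simp only [avg]
      congr 2 <;> refine hh fun i hi => ?_ <;>
        simp only [Pi.add_apply, raise_congr _ _ _ (hx i hi)]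
    have depR : ∀ (h) (T : Set P), DependsOn h T → ∀ x, DependsOn (fun y => avg h x y) T := by
      intro h T hh x y y' hy
      simp only [avg]
      congr 2 <;> refine hh fun i hi => ?_ <;>
        simp only [Pi.add_apply, raise_congr _ _ _ (hy i hi)]
    simp only [CoinTree.expect_succ]
    calc _ ≤ 𝔼 a, 𝔼 b, avg f (A.score a) (B.score b) * avg g (A.score a) (B.score b) := by
          refine expect_le_expect fun a _ => expect_le_expect fun b _ => ?_
          rw [← havg f, ← havg g]
          simp only [score_duel]
          exact expect_mul_le_of_single hf hg hfT hgT _ _ _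
      _ ≤ 𝔼 a, (𝔼 b, avg f (A.score a) (B.score b)) * 𝔼 b, avg g (A.score a) (B.score b) :=
          expect_le_expect fun a _ => ihB hB T _ _ (monoR f hf _) (monoR g hg _)
            (depR f _ hfT _) (depR g _ hgT _)
      _ ≤ (𝔼 a, 𝔼 b, avg f (A.score a) (B.score b)) * 𝔼 a, 𝔼 b, avg g (A.score a) (B.score b) :=
          ihA hA T (fun x => 𝔼 b, avg f x (B.score b)) (fun x => 𝔼 b, avg g x (B.score b))
            (Monotone.expect fun b => monoL f hf _) (Monotone.expect fun b => monoL g hg _)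
            (DependsOn.expect fun b => depL f _ hfT _) (DependsOn.expect fun b => depL g _ hgT _)
      _ = _ := by simp only [havg]

end KnockoutBracket

/-- Flipping one fair coin does not change averages over the cube. -/
theorem expect_ite_coord {ι : Type*} [Fintype ι] [DecidableEq ι] (e : ι) {u v : (ι → Bool) → ℝ}
    (hu : DependsOn u {e}ᶜ) (hv : DependsOn v {e}ᶜ) :
    𝔼 t, (if t e = true then u t else v t) = (𝔼 t, u t + 𝔼 t, v t) / 2 := by
  let φ : (ι → Bool) → ι → Bool := fun t => Function.update t e (!t e)
  have hφ : Function.Involutive φ := fun t => by simp [φ]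
  have hne : ∀ t, ∀ i ∈ ({e}ᶜ : Set ι), φ t i = t i := fun t i hi =>
    Function.update_of_ne hi _ _
  have hflip : 𝔼 t, (if t e = true then u t else v t) = 𝔼 t, if t e = true then v t else u t := by
    refine Fintype.expect_equiv hφ.toPerm _ _ fun t => ?_
    have h1 : u (φ t) = u t := hu (hne t)
    have h2 : v (φ t) = v t := hv (hne t)
    have h3 : φ t e = !t e := by simp [φ]
    simp only [Function.Involutive.coe_toPerm, h1, h2, h3]
    cases t e <;> simp
  have hsum : 𝔼 t, (if t e = true then u t else v t) + 𝔼 t, (if t e = true then v t else u t) =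
      𝔼 t, u t + 𝔼 t, v t := by
    rw [← expect_add_distrib, ← expect_add_distrib]
    refine expect_congr rfl fun t _ => ?_
    split_ifs
    · rfl
    · exact add_comm _ _
  linarith

/-- The pairs of players, each listed once. -/
abbrev DuelPair (P : Type*) [LT P] := {e : P × P // e.1 < e.2}

/-- The event that `i` defeats `j`, on the cube of all results of the duels. -/
def cubeDuel (P : Type*) [LinearOrder P] (i j : P) : Set (DuelPair P → Bool) :=
  {t | if h : i < j then t ⟨(i, j), h⟩ = true else
    if h : j < i then t ⟨(j, i), h⟩ = false else False}

/-- The pairs of players of a list. -/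
def duelPairs {P : Type*} [LT P] (l : List P) : Set (DuelPair P) :=
  {e | e.1.1 ∈ l ∧ e.1.2 ∈ l}

theorem mem_cubeDuel_congr {P : Type*} [LinearOrder P] {i j : P} {t t' : DuelPair P → Bool}
    (h : ∀ e : DuelPair P, (e.1 = (i, j) ∨ e.1 = (j, i)) → t e = t' e) :
    t ∈ cubeDuel P i j ↔ t' ∈ cubeDuel P i j := by
  simp only [cubeDuel, Set.mem_ofPred_eq]
  split_ifs with h1 h2
  · rw [h _ (Or.inl rfl)]
  · rw [h _ (Or.inr rfl)]
  · rfl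

open Classical in
theorem expect_ite_cubeDuel {P : Type*} [LinearOrder P] [Fintype P] {i j : P} (hij : i ≠ j)
    {u v : (DuelPair P → Bool) → ℝ}
    (hu : DependsOn u {e | ¬(e.1 = (i, j) ∨ e.1 = (j, i))})
    (hv : DependsOn v {e | ¬(e.1 = (i, j) ∨ e.1 = (j, i))}) :
    𝔼 t, (if t ∈ cubeDuel P i j then u t else v t) = (𝔼 t, u t + 𝔼 t, v t) / 2 := by
  rcases lt_or_gt_of_ne hij with h | h
  · have hs : {e : DuelPair P | ¬(e.1 = (i, j) ∨ e.1 = (j, i))} ⊆ {⟨(i, j), h⟩}ᶜ := by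
      intro e he hee
      exact he (Or.inl (by rw [Set.mem_singleton_iff.1 hee]))
    rw [← expect_ite_coord ⟨(i, j), h⟩ (hu.mono hs) (hv.mono hs)]
    exact expect_congr rfl fun t _ => by simp [cubeDuel, h]
  · have hs : {e : DuelPair P | ¬(e.1 = (i, j) ∨ e.1 = (j, i))} ⊆ {⟨(j, i), h⟩}ᶜ := by
      intro e he hee
      exact he (Or.inr (by rw [Set.mem_singleton_iff.1 hee]))
    rw [add_comm, ← expect_ite_coord ⟨(j, i), h⟩ (hv.mono hs) (hu.mono hs)]
    refine expect_congr rfl fun t _ => ?_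
    simp only [cubeDuel, h, not_lt_of_gt h, Set.mem_ofPred_eq, dite_true, dite_false]
    cases t ⟨(j, i), h⟩ <;> simp

namespace KnockoutBracket

variable {P Ω Ω' : Type*}

theorem winner_mem_entrants (D : P → P → Set Ω) {ℓ : ℕ} (B : KnockoutBracket P ℓ) (ω : Ω) :
    B.winner D ω ∈ B.entrants := by
  induction B with
  | player i => simp [winner, entrants]
  | duel A B ihA ihB =>
    simp only [winner, entrants, List.mem_append]
    split_ifs
    · exact Or.inl ihA
    · exact Or.inr ihB

theorem winner_congr {D : P → P → Set Ω} {D' : P → P → Set Ω'} {ω : Ω} {ω' : Ω'} {ℓ : ℕ}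
    (B : KnockoutBracket P ℓ)
    (h : ∀ i ∈ B.entrants, ∀ j ∈ B.entrants, i ≠ j → (ω ∈ D i j ↔ ω' ∈ D' i j)) :
    B.winner D ω = B.winner D' ω' := by
  induction B with
  | player i => rfl
  | duel A B ihA ihB =>
    simp only [entrants, List.mem_append] at h
    have hA := ihA fun i hi j hj => h i (Or.inl hi) j (Or.inl hj)
    have hB := ihB fun i hi j hj => h i (Or.inr hi) j (Or.inr hj)
    simp only [winner]
    rw [hA, hB]
    by_cases hw : A.winner D' ω' = B.winner D' ω'
    · simp [hw]
    · classical
      exact if_congr (h _ (Or.inl (A.winner_mem_entrants D' ω')) _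
        (Or.inr (B.winner_mem_entrants D' ω')) hw) rfl rfl

theorem gamesWon_congr {D : P → P → Set Ω} {D' : P → P → Set Ω'} {ω : Ω} {ω' : Ω'} {ℓ : ℕ}
    (B : KnockoutBracket P ℓ)
    (h : ∀ i ∈ B.entrants, ∀ j ∈ B.entrants, i ≠ j → (ω ∈ D i j ↔ ω' ∈ D' i j)) (k : P) :
    B.gamesWon D k ω = B.gamesWon D' k ω' := by
  induction B with
  | player i => rfl
  | duel A B ihA ihB =>
    have hw := winner_congr _ h
    simp only [entrants, List.mem_append] at h
    have hA := ihA fun i hi j hj => h i (Or.inl hi) j (Or.inl hj)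
    have hB := ihB fun i hi j hj => h i (Or.inr hi) j (Or.inr hj)
    simp only [gamesWon, hA, hB]
    rw [hw]

/-- The numbers of games won and the winner, as functions of the results of all duels. -/
noncomputable def cubeOutcome [LinearOrder P] {ℓ : ℕ} (B : KnockoutBracket P ℓ)
    (t : DuelPair P → Bool) : (P → ℕ) × P :=
  (fun i => B.gamesWon (cubeDuel P) i t, B.winner (cubeDuel P) t)

theorem dependsOn_cubeOutcome [LinearOrder P] {ℓ : ℕ} (B : KnockoutBracket P ℓ) :
    DependsOn B.cubeOutcome (duelPairs B.entrants) := by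
  intro t t' h
  have key : ∀ i ∈ B.entrants, ∀ j ∈ B.entrants, i ≠ j →
      (t ∈ cubeDuel P i j ↔ t' ∈ cubeDuel P i j) := by
    intro i hi j hj _
    refine mem_cubeDuel_congr fun e he => h e ?_
    rcases he with he | he <;> simp [duelPairs, he, hi, hj]
  simp only [cubeOutcome, Prod.mk.injEq]
  exact ⟨funext fun k => gamesWon_congr B key k, winner_congr B key⟩

/-- Averaging over the results of the duels inside a bracket is averaging over independent fair
coins at its nodes. -/
theorem expect_cubeOutcome [LinearOrder P] [Fintype P] {ℓ : ℕ} (B : KnockoutBracket P ℓ)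
    (hB : B.entrants.Nodup) (g : (P → ℕ) × P → (DuelPair P → Bool) → ℝ)
    (hg : ∀ x, x.2 ∈ B.entrants → DependsOn (g x) (duelPairs B.entrants)ᶜ) :
    𝔼 t, g (B.cubeOutcome t) t = 𝔼 c, 𝔼 t, g (B.outcome c) t := by
  classical
  induction B generalizing g with
  | player i => rw [CoinTree.expect_zero]; rfl
  | @duel ℓ A B ihA ihB =>
    have hnd := hB
    simp only [entrants, List.nodup_append'] at hB
    obtain ⟨hA, hB, hAB⟩ := hB
    let res (x y : (P → ℕ) × P) (c : Bool) : (P → ℕ) × P :=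
      let w := bif c then x.2 else y.2
      (fun i => x.1 i + y.1 i + if w = i then 1 else 0, w)
    let G (x y : (P → ℕ) × P) (t : DuelPair P → Bool) : ℝ :=
      if t ∈ cubeDuel P x.2 y.2 then g (res x y true) t else g (res x y false) t
    have hsub : ∀ C : List P, C ⊆ (A.duel B).entrants →
        (duelPairs (A.duel B).entrants)ᶜ ⊆ (duelPairs C)ᶜ := by
      intro C hC e he he'
      exact he ⟨hC he'.1, hC he'.2⟩
    have hsA : A.entrants ⊆ (A.duel B).entrants := by simp [entrants]
    have hsB : B.entrants ⊆ (A.duel B).entrants := by simp [entrants]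
    have hgx : ∀ x y c, x.2 ∈ A.entrants → y.2 ∈ B.entrants →
        DependsOn (g (res x y c)) (duelPairs (A.duel B).entrants)ᶜ := by
      intro x y c hx hy
      refine hg _ ?_
      cases c
      · exact hsB hy
      · exact hsA hx
    have hmix : ∀ x y : P, x ∈ A.entrants → y ∈ B.entrants → ∀ e : DuelPair P,
        (e.1 = (x, y) ∨ e.1 = (y, x)) →
          e ∈ (duelPairs A.entrants)ᶜ ∧ e ∈ (duelPairs B.entrants)ᶜ ∧
            e ∈ duelPairs (A.duel B).entrants := by
      intro x y hx hy e he
      have hx' : x ∉ B.entrants := fun h => hAB hx h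
      have hy' : y ∉ A.entrants := fun h => hAB h hy
      rcases he with he | he <;>
        simp [duelPairs, he, entrants, hx, hy, hx', hy']
    calc 𝔼 t, g ((A.duel B).cubeOutcome t) t = 𝔼 t, G (A.cubeOutcome t) (B.cubeOutcome t) t := by
          refine expect_congr rfl fun t _ => ?_
          simp only [G, res, cubeOutcome, gamesWon, winner]
          split_ifs <;> rfl
      _ = 𝔼 a, 𝔼 t, G (A.outcome a) (B.cubeOutcome t) t := by
          refine ihA hA (fun x t => G x (B.cubeOutcome t) t) ?_
          intro x hx t t' h
          have hout : B.cubeOutcome t = B.cubeOutcome t' :=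
            B.dependsOn_cubeOutcome fun e he => h e fun he' => hAB he'.1 he.1
          have hy : (B.cubeOutcome t').2 ∈ B.entrants := winner_mem_entrants _ _ _
          have hc := fun c => hgx x (B.cubeOutcome t') c hx hy
            (fun e he => h e (hsub _ hsA he))
          have hm : t ∈ cubeDuel P x.2 (B.cubeOutcome t').2 ↔
              t' ∈ cubeDuel P x.2 (B.cubeOutcome t').2 :=
            mem_cubeDuel_congr fun e he => h e (hmix _ _ hx hy e he).1
          simp only [G, hout, hc]
          exact if_congr hm rfl rfl
      _ = 𝔼 a, 𝔼 b, 𝔼 t, G (A.outcome a) (B.outcome b) t := by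
          refine expect_congr rfl fun a _ => ?_
          refine ihB hB (fun y t => G (A.outcome a) y t) ?_
          intro y hy t t' h
          have hx := (A.outcome_spec hA a).1
          have hc := fun c => hgx (A.outcome a) y c hx hy (fun e he => h e (hsub _ hsB he))
          have hm : t ∈ cubeDuel P (A.outcome a).2 y.2 ↔ t' ∈ cubeDuel P (A.outcome a).2 y.2 :=
            mem_cubeDuel_congr fun e he => h e (hmix _ _ hx hy e he).2.1
          simp only [G, hc]
          exact if_congr hm rfl rfl
      _ = _ := by
          rw [CoinTree.expect_succ]
          refine expect_congr rfl fun a _ => expect_congr rfl fun b _ => ?_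
          have hx := (A.outcome_spec hA a).1
          have hy := (B.outcome_spec hB b).1
          have hs : (duelPairs (A.duel B).entrants)ᶜ ⊆
              {e | ¬(e.1 = ((A.outcome a).2, (B.outcome b).2) ∨
                e.1 = ((B.outcome b).2, (A.outcome a).2))} :=
            fun e he he' => he (hmix _ _ hx hy e he').2.2
          have hr : ∀ c, (A.duel B).outcome (a, b, c) = res (A.outcome a) (B.outcome b) c := by
            intro c
            simp only [outcome, res, Prod.mk.injEq, and_true]
            ext i
            congr
          rw [hr, hr]
          exact expect_ite_cubeDuel (fun h => hAB hx (by rwa [h]))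
            ((hgx _ _ true hx hy).mono hs) ((hgx _ _ false hx hy).mono hs)

/-- The numbers of games won as real functions of the results of all duels. -/
noncomputable def cubeScore [LinearOrder P] {ℓ : ℕ} (B : KnockoutBracket P ℓ)
    (t : DuelPair P → Bool) (i : P) : ℝ :=
  B.gamesWon (cubeDuel P) i t

theorem expect_cubeScore [LinearOrder P] [Fintype P] {ℓ : ℕ} (B : KnockoutBracket P ℓ)
    (hB : B.entrants.Nodup) (f : (P → ℝ) → ℝ) :
    𝔼 t, f (B.cubeScore t) = 𝔼 c, f (B.score c) :=
  (B.expect_cubeOutcome hB (fun x _ => f fun i => x.1 i) fun _ _ _ _ _ => rfl).trans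
    (expect_congr rfl fun _ _ => Fintype.expect_const _)

theorem isUniformNegAssoc_cubeScore [LinearOrder P] [Fintype P] {ℓ : ℕ}
    (B : KnockoutBracket P ℓ) (hB : B.entrants.Nodup) : IsUniformNegAssoc B.cubeScore := by
  intro A f g hf hg hfA hgA
  rw [B.expect_cubeScore hB f, B.expect_cubeScore hB g,
    B.expect_cubeScore hB fun x => f x * g x]
  exact B.isUniformNegAssoc_score hB A f g hf hg hfA hgA

end KnockoutBracket

section Supermodular

variable {α ι : Type*} [Fintype α] [DecidableEq ι] {ψ : (ι → ℝ) → ℝ}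

/-- The increments of a supermodular function in one coordinate increase with the others. -/
theorem IsSupermodular.monotone_increment (hψ : IsSupermodular ψ) (k : ι) {a b : ℝ} (hab : a ≤ b) :
    Monotone fun x => ψ (Function.update x k b) - ψ (Function.update x k a) := by
  intro x y hxy
  have h := hψ (Function.update x k b) (Function.update y k a)
  have h1 : Function.update x k b ⊔ Function.update y k a = Function.update y k b := by
    ext i
    rcases eq_or_ne i k with rfl | hi
    · simp [hab]
    · simp [hi, hxy i]
  have h2 : Function.update x k b ⊓ Function.update y k a = Function.update x k a := by
    ext i
    rcases eq_or_ne i k with rfl | hi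
    · simp [hab]
    · simp [hi, hxy i]
  rw [h1, h2] at h
  simp only
  linarith

theorem IsSupermodular.comp_piecewise (hψ : IsSupermodular ψ) (T : Finset ι) (z : ι → ℝ) :
    IsSupermodular fun x => ψ (T.piecewise z x) := by
  intro x y
  have h := hψ (T.piecewise z x) (T.piecewise z y)
  have h1 : T.piecewise z x ⊔ T.piecewise z y = T.piecewise z (x ⊔ y) := by
    ext i
    by_cases hi : i ∈ T <;> simp [hi]
  have h2 : T.piecewise z x ⊓ T.piecewise z y = T.piecewise z (x ⊓ y) := by
    ext i
    by_cases hi : i ∈ T <;> simp [hi]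
  rwa [h1, h2] at h

theorem dependsOn_comp_update (ψ : (ι → ℝ) → ℝ) (k : ι) (a : ℝ) :
    DependsOn (fun x => ψ (Function.update x k a)) {k}ᶜ := by
  intro x y h
  simp only
  congr 1
  ext i
  rcases eq_or_ne i k with rfl | hi
  · simp
  · simpa [hi] using h i hi

/-- A function of an integer coordinate is the sum of its increments. -/
theorem eq_sum_increments (ψ : (ι → ℝ) → ℝ) (k : ι) {N M : ℕ} (hNM : N ≤ M) (x : ι → ℝ) :
    ψ (Function.update x k N) = ψ (Function.update x k 0) + ∑ j ∈ range M,
      (if ((j + 1 : ℕ) : ℝ) ≤ N then (1 : ℝ) else 0) *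
        (ψ (Function.update x k (j + 1 : ℕ)) - ψ (Function.update x k j)) := by
  have h1 : ∑ j ∈ range M, (if ((j + 1 : ℕ) : ℝ) ≤ N then (1 : ℝ) else 0) *
        (ψ (Function.update x k (j + 1 : ℕ)) - ψ (Function.update x k j)) =
      ∑ j ∈ range N, (ψ (Function.update x k (j + 1 : ℕ)) - ψ (Function.update x k j)) := by
    simp only [Nat.cast_le, Nat.succ_le_iff, ite_mul, one_mul, zero_mul]
    rw [← sum_filter]
    refine sum_congr ?_ fun _ _ => rfl
    ext j
    simp only [mem_filter, mem_range]
    omega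
  rw [h1, sum_range_sub fun j : ℕ => ψ (Function.update x k j)]
  simp

/-- Replacing one coordinate of a negatively associated vector by an independent copy increases the
average of a supermodular function. -/
theorem IsUniformNegAssoc.expect_le_expect_update [Nonempty α] {X : α → ι → ℝ}
    (hX : IsUniformNegAssoc X) (hnat : ∀ a i, ∃ N : ℕ, X a i = N) (hψ : IsSupermodular ψ) (k : ι) :
    𝔼 a, ψ (X a) ≤ 𝔼 a, 𝔼 d, ψ (Function.update (X a) k (X d k)) := by
  choose N hN using fun a => hnat a k
  let M := univ.sup N
  have hM : ∀ a, N a ≤ M := fun a => le_sup (f := N) (mem_univ a)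
  let I (j : ℕ) (x : ι → ℝ) : ℝ := if ((j + 1 : ℕ) : ℝ) ≤ x k then 1 else 0
  let Δ (j : ℕ) (x : ι → ℝ) : ℝ :=
    ψ (Function.update x k (j + 1 : ℕ)) - ψ (Function.update x k j)
  have key : ∀ a d, ψ (Function.update (X a) k (X d k)) =
      ψ (Function.update (X a) k 0) + ∑ j ∈ range M, I j (X d) * Δ j (X a) := by
    intro a d
    simp only [I, hN, Δ]
    exact eq_sum_increments ψ k (hM d) (X a)
  have hI : ∀ j, Monotone (I j) := fun j x y hxy => by
    have := hxy k
    simp only [I]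
    split_ifs with h1 h2 <;> first | exact le_rfl | exact zero_le_one | exact absurd (h1.trans this) h2
  have hId : ∀ j, DependsOn (I j) {k} := fun j x y hxy => by
    simp only [I, hxy k rfl]
  have hΔ : ∀ j, Monotone (Δ j) := fun j =>
    hψ.monotone_increment k (Nat.cast_le.2 j.le_succ)
  have hΔd : ∀ j, DependsOn (Δ j) {k}ᶜ := fun j x y hxy => by
    exact congrArg₂ (· - ·) (dependsOn_comp_update ψ k _ hxy) (dependsOn_comp_update ψ k _ hxy)
  have hL : ∀ a, ψ (X a) =
      ψ (Function.update (X a) k 0) + ∑ j ∈ range M, I j (X a) * Δ j (X a) := fun a => by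
    rw [← key a a, Function.update_eq_self]
  simp only [key, hL, expect_add_distrib, expect_sum_comm, Fintype.expect_const]
  refine add_le_add le_rfl (sum_le_sum fun j _ => ?_)
  refine (hX {k} (I j) (Δ j) (hI j) (hΔ j) (hId j) (hΔd j)).trans_eq ?_
  rw [expect_mul_expect, expect_comm]

/-- Negative association implies negative supermodular dependence, for a vector of natural numbers
on a finite set with the uniform distribution. -/
theorem IsUniformNegAssoc.expect_le_expect_pi [Nonempty α] [Fintype ι] {X : α → ι → ℝ}
    (hX : IsUniformNegAssoc X) (hnat : ∀ a i, ∃ N : ℕ, X a i = N) (hψ : IsSupermodular ψ) :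
    𝔼 a, ψ (X a) ≤ 𝔼 c : ι → α, ψ fun i => X (c i) i := by
  have main : ∀ T : Finset ι,
      𝔼 a, ψ (X a) ≤ 𝔼 c : ι → α, 𝔼 a, ψ (T.piecewise (fun i => X (c i) i) (X a)) := by
    intro T
    induction T using Finset.induction_on with
    | empty => simp only [piecewise_empty, Fintype.expect_const, le_refl]
    | insert k T hk ih =>
      refine ih.trans ?_
      have hstep : 𝔼 c : ι → α, 𝔼 a, ψ (T.piecewise (fun i => X (c i) i) (X a)) ≤
          𝔼 c : ι → α, 𝔼 a, 𝔼 d,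
            ψ ((insert k T).piecewise (fun i => X (Function.update c k d i) i) (X a)) := by
        refine expect_le_expect fun c _ => ?_
        refine (hX.expect_le_expect_update hnat
          (hψ.comp_piecewise T fun i => X (c i) i) k).trans_eq ?_
        refine expect_congr rfl fun a _ => expect_congr rfl fun d _ => congrArg ψ ?_
        ext i
        rcases eq_or_ne i k with rfl | hi
        · simp [hk]
        · by_cases hT : i ∈ T <;> simp [hT, hi]
      refine hstep.trans_eq ?_
      have hupd : ∀ F : (ι → α) → ℝ,
          𝔼 c : ι → α, 𝔼 d, F (Function.update c k d) = 𝔼 c, F c := by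
        intro F
        let e : α × ({j // j ≠ k} → α) ≃ (ι → α) := (Equiv.funSplitAt k α).symm
        have he : ∀ H : (ι → α) → ℝ, 𝔼 c, H c = 𝔼 d, 𝔼 r, H (e (d, r)) := by
          intro H
          rw [← expect_product' univ univ fun d r => H (e (d, r)), univ_product_univ]
          exact (Fintype.expect_equiv e _ _ fun _ => rfl).symm
        have hu : ∀ d d' r, Function.update (e (d', r)) k d = e (d, r) := by
          intro d d' r
          ext i
          rcases eq_or_ne i k with rfl | hi
          · simp [e]
          · simp [e, hi]
        rw [he, he]
        simp only [hu, Fintype.expect_const]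
        exact expect_comm _ _ _
      have hsw := hupd fun c => 𝔼 a, ψ ((insert k T).piecewise (fun i => X (c i) i) (X a))
      rw [← hsw]
      exact expect_congr rfl fun c _ => expect_comm _ _ _
  simpa using main univ

end Supermodular

/-- The results of the duels, one coordinate for each pair. -/
noncomputable def duelResults {Ω : Type*} {n : ℕ} (D : Fin n → Fin n → Set Ω) (ω : Ω)
    (e : DuelPair (Fin n)) : Bool :=
  open Classical in decide (ω ∈ D e.1.1 e.1.2)

section Transfer

variable {Ω : Type*} [MeasurableSpace Ω] {μ : Measure Ω} {n : ℕ} {p : Fin n → Fin n → ℝ}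
  {D : Fin n → Fin n → Set Ω}

theorem mem_cubeDuel_duelResults (hD : IsDuelModel μ p D) (ω : Ω) {i j : Fin n} (hij : i ≠ j) :
    ω ∈ D i j ↔ duelResults D ω ∈ cubeDuel (Fin n) i j := by
  rcases lt_or_gt_of_ne hij with h | h
  · simp [cubeDuel, duelResults, h]
  · simp [cubeDuel, duelResults, h, not_lt_of_gt h, hD.compl j i hij.symm]

theorem measurable_duelResults (hD : IsDuelModel μ p D) : Measurable (duelResults D) := by
  refine measurable_pi_iff.2 fun e => measurable_to_bool ?_
  convert hD.measurableSet e.1.1 e.1.2 e.2.ne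
  ext ω
  simp [duelResults]

theorem measureReal_map_duelResults [IsProbabilityMeasure μ] (hD : IsDuelModel μ p D)
    (hp : EqualStrength p) (t : DuelPair (Fin n) → Bool) :
    (μ.map (duelResults D)).real {t} = (Fintype.card (DuelPair (Fin n) → Bool) : ℝ)⁻¹ := by
  let F (e : DuelPair (Fin n)) : Set Ω := if t e then D e.1.1 e.1.2 else (D e.1.1 e.1.2)ᶜ
  have hF : ∀ e, μ.real (F e) = 1 / 2 := by
    intro e
    have h := (hD.prob _ _ e.2.ne).trans (hp _ _ e.2.ne)
    simp only [F]
    split_ifs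
    · exact h
    · rw [probReal_compl_eq_one_sub (hD.measurableSet _ _ e.2.ne), h]
      norm_num
  have hpre : duelResults D ⁻¹' {t} = ⋂ e, F e := by
    ext ω
    simp only [Set.mem_preimage, Set.mem_singleton_iff, Set.mem_iInter, funext_iff]
    refine forall_congr' fun e => ?_
    cases h : t e <;> simp [F, h, duelResults]
  have hm : ∀ e, MeasurableSet[MeasurableSpace.generateFrom {D e.1.1 e.1.2}] (F e) := by
    intro e
    have h := MeasurableSpace.measurableSet_generateFrom (Set.mem_singleton (D e.1.1 e.1.2))
    simp only [F]
    split_ifs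
    · exact h
    · exact h.compl
  have hi : iIndep (fun e : DuelPair (Fin n) => MeasurableSpace.generateFrom {D e.1.1 e.1.2}) μ :=
    hD.indep
  have hprod := hi.meas_iInter hm
  rw [map_measureReal_apply (measurable_duelResults hD) (measurableSet_singleton t), hpre,
    Measure.real, hprod, ENNReal.toReal_prod]
  have : ∀ e, (μ (F e)).toReal = 1 / 2 := hF
  simp [this]

end Transfer

theorem integral_eq_expect_of_uniform {α : Type*} [Fintype α] [MeasurableSpace α]
    [MeasurableSingletonClass α] {ν : Measure α} [IsFiniteMeasure ν]
    (hν : ∀ a, ν.real {a} = (Fintype.card α : ℝ)⁻¹) (f : α → ℝ) : ∫ a, f a ∂ν = 𝔼 a, f a := by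
  rw [integral_fintype .of_finite]
  simp [hν, Fintype.expect_eq_sum_div_card, ← mul_sum, div_eq_inv_mul]

theorem integral_pi_map_eq_expect {α ι : Type*} [Fintype α] [Fintype ι] [DecidableEq ι] [MeasurableSpace α]
    [DiscreteMeasurableSpace α] {ν : Measure α} [IsProbabilityMeasure ν]
    (hν : ∀ a, ν.real {a} = (Fintype.card α : ℝ)⁻¹) (X : α → ι → ℝ) {ψ : (ι → ℝ) → ℝ}
    (hψ : AEStronglyMeasurable ψ (Measure.pi fun i => ν.map fun a => X a i)) :
    ∫ x, ψ x ∂(Measure.pi fun i => ν.map fun a => X a i) = 𝔼 c : ι → α, ψ fun i => X (c i) i := by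
  have hm : ∀ i, AEMeasurable (fun a => X a i) ν := fun i => (Measurable.of_discrete).aemeasurable
  have : ∀ i, IsProbabilityMeasure (ν.map fun a => X a i) := fun i =>
    Measure.isProbabilityMeasure_map (hm i)
  have hmap := Measure.pi_map_pi hm
  rw [← hmap] at hψ ⊢
  rw [integral_map (Measurable.of_discrete).aemeasurable hψ]
  refine integral_eq_expect_of_uniform (fun c => ?_) _
  have hpi : ∀ i, (ν {c i}).toReal = (Fintype.card α : ℝ)⁻¹ := fun i => hν _
  simp [Measure.real, Measure.pi_singleton, ENNReal.toReal_prod, hpi]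

theorem theorem3p1 {Ω : Type*} [MeasurableSpace Ω] (μ : Measure Ω) [IsProbabilityMeasure μ]
    (ℓ n : ℕ) (hℓ : 2 ≤ ℓ) (hn : n = 2 ^ ℓ)
    (p : Fin n → Fin n → ℝ) (hp : EqualStrength p)
    (D : Fin n → Fin n → Set Ω) (hD : IsDuelModel μ p D)
    (B : KnockoutBracket (Fin n) ℓ) (hB : B.IsDraw)
    (S : Fin n → Ω → ℝ) (hS : ∀ i ω, S i ω = B.gamesWon D i ω) :
    IsNegAssoc μ S ∧ IsNSMD μ S := by
  have hnd : B.entrants.Nodup := List.nodup_iff_count_le_one.2 fun i => (hB i).le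
  have hNA := B.isUniformNegAssoc_cubeScore hnd
  have hR := measurable_duelResults hD
  have hSR : ∀ i, S i = fun ω => B.cubeScore (duelResults D ω) i := by
    intro i
    ext ω
    rw [hS, KnockoutBracket.cubeScore, KnockoutBracket.gamesWon_congr B fun i _ j _ hij =>
      mem_cubeDuel_duelResults hD ω hij]
  have hSm : ∀ i, AEMeasurable (S i) μ := fun i => by
    rw [hSR i]
    exact ((Measurable.of_discrete (f := fun t => B.cubeScore t i)).comp hR).aemeasurable
  have hν := measureReal_map_duelResults hD hp
  have : IsProbabilityMeasure (μ.map (duelResults D)) :=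
    Measure.isProbabilityMeasure_map hR.aemeasurable
  have hint : ∀ f : (Fin n → ℝ) → ℝ, ∫ ω, f (fun i => S i ω) ∂μ = 𝔼 t, f (B.cubeScore t) := by
    intro f
    rw [← integral_eq_expect_of_uniform hν, integral_map hR.aemeasurable .of_discrete]
    simp only [hSR]
  refine ⟨⟨hSm, ?_⟩, hSm, ?_⟩
  · intro A₁ A₂ hA ψ₁ ψ₂ h₁ h₂ _ _ _
    let f (x : Fin n → ℝ) : ℝ := ψ₁ fun i => x i
    let g (x : Fin n → ℝ) : ℝ := ψ₂ fun i => x i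
    have hf : Monotone f := fun x y hxy => h₁ fun i => hxy i
    have hg : Monotone g := fun x y hxy => h₂ fun i => hxy i
    have hfd : DependsOn f A₁ := fun x y hxy => congrArg ψ₁ (funext fun i => hxy i i.2)
    have hgd : DependsOn g A₁ᶜ := fun x y hxy =>
      congrArg ψ₂ (funext fun i => hxy i (hA.subset_compl_left i.2))
    let mf := 𝔼 t, f (B.cubeScore t)
    let mg := 𝔼 t, g (B.cubeScore t)
    have h := hNA A₁ (fun x => f x - mf) (fun x => g x - mg)
      (fun x y hxy => sub_le_sub_right (hf hxy) _) (fun x y hxy => sub_le_sub_right (hg hxy) _)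
      (fun x y hxy => by simp only [hfd hxy]) (fun x y hxy => by simp only [hgd hxy])
    rw [expect_sub_distrib univ _ fun _ => mf, Fintype.expect_const, sub_self, zero_mul] at h
    refine le_of_eq_of_le ?_ h
    rw [← hint fun x => (f x - mf) * (g x - mg)]
    simp only [covariance, mf, mg, ← hint]
    rfl
  · intro ψ hψ _ hψi
    have hmap : ∀ i, μ.map (S i) = (μ.map (duelResults D)).map fun t => B.cubeScore t i := by
      intro i
      rw [Measure.map_map .of_discrete hR, hSR i]
      rfl
    simp only [hmap] at hψi ⊢
    rw [hint, integral_pi_map_eq_expect hν B.cubeScore hψi.aestronglyMeasurable]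
    exact hNA.expect_le_expect_pi (fun t i => ⟨_, rfl⟩) hψ
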